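/- Let $S$ be a finite-dimensional complex module over the real Clifford algebra of $\mathbb R^n$ with the relation $x\cdot y+y\cdot x=-2\langle x,y\rangle$ (for example the spinor module, on whose half-spin summands, for even $n$, the statement restricts to $\mathrm{Hom}(S^\pm,S^\mp)$), and write $x\cdot\in\mathrm{End}(S)$ for Clifford multiplication by $x\in\mathbb R^n$. The locally integrable functions $\slashed r^{\lambda}(x)=|x|^{\lambda-1}\,x\cdot$, $\mathrm{Re}\,\lambda>-n$, define tempered distributions with values in $\mathrm{End}(S)$, and $\lambda\mapsto\slashed r^\lambda$ extends uniquely to a meromorphic family of $\mathrm{End}(S)$-valued tempered distributions on $\mathbb C$ that is analytic away from $\{-n-1-2k: k\in\mathbb N_0\}$ (after pairing with any Schwartz function); it is again denoted $\slashed r^\lambda$. Let the Fourier transform be $\mathcal F(f)(\xi)=\int_{\mathbb R^n}f(x)e^{i\langle x,\xi\rangle}\,dx$ on Schwartz functions, extended by duality to tempered distributions, and let $$c_\lambda=2^{\lambda+n}\pi^{\frac n2}\,\frac{\Gamma\left(\frac{\lambda+n}{2}\right)}{\Gamma\left(-\frac\lambda2\right)},\qquad \slashed c_\lambda=-i\,\frac{c_{\lambda+1}}{\lambda+1}.$$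 Then, as meromorphic families in $\lambda\in\mathbb C$, $$\mathcal F(\slashed r^\lambda)(\xi)=\slashed c_\lambda\,\slashed r^{-\lambda-n}(\xi).$$ That is: the identity holds for all $\lambda\in\mathbb C$ with $\lambda\notin\{-n-1-2k\}$, $\lambda\notin\{1+2k\}$ ($k\in\mathbb N_0$) and $\lambda\neq-1$; and for every $\lambda\notin\{-n-1-2k: k\in\mathbb N_0\}$ one has $\mathcal F(\slashed r^\lambda)=\lim_{\mu\to\lambda,\,\mu\ne\lambda}\slashed c_\mu\,\slashed r^{-\mu-n}$, the limit being taken pointwise on Schwartz functions. -/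

import Mathlib

open MeasureTheory Filter Topology SchwartzMap
open scoped FourierTransform

noncomputable section

namespace SpinorRiesz

/-- Euclidean space `ℝⁿ`. -/
abbrev E (n : ℕ) : Type := EuclideanSpace ℝ (Fin n)

/-! ### The Fourier transform `𝓕(f)(ξ) = ∫ f(x) e^{i⟨x, ξ⟩} dx` -/

/-- The dilation `ξ ↦ (2π)⁻¹ ξ` of `ℝⁿ`. -/
def dilation (n : ℕ) : E n ≃L[ℝ] E n :=
  ContinuousLinearEquiv.smulLeft (Units.mk0 ((2 * Real.pi)⁻¹) (inv_ne_zero Real.two_pi_pos.ne'))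

/-- The Fourier transform `f ↦ ∫ f(x) e^{i⟨x, ξ⟩} dx` on scalar Schwartz functions, obtained from
Mathlib's `𝓕⁻ f (η) = ∫ f(x) e^{2πi⟨x, η⟩} dx` by substituting `η = ξ / (2π)`; the integral formula
is `fourierSchwartz_apply`. -/
def fourierSchwartz (n : ℕ) : 𝓢(E n, ℂ) →L[ℂ] 𝓢(E n, ℂ) :=
  (compCLMOfContinuousLinearEquiv ℂ (dilation n)).comp
    (FourierTransform.fourierInvCLM ℂ 𝓢(E n, ℂ))

theorem fourierSchwartz_apply (n : ℕ) (f : 𝓢(E n, ℂ)) (ξ : E n) :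
    fourierSchwartz n f ξ = ∫ x, f x * Complex.exp (Complex.I * (inner ℝ x ξ : ℝ)) := by
  have h : fourierSchwartz n f ξ = 𝓕⁻ (f : E n → ℂ) ((2 * Real.pi)⁻¹ • ξ) := by
    rw [← SchwartzMap.fourierInv_coe]; rfl
  rw [h, Real.fourierInv_eq']
  congr 1
  ext x
  rw [smul_eq_mul, mul_comm, inner_smul_right]
  congr 2
  have := Real.pi_ne_zero
  push_cast
  field_simp

/-- The Fourier transform of vector-valued tempered distributions, by duality:
`⟨𝓕 T, φ⟩ = ⟨T, 𝓕 φ⟩`. -/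
def fourierTempered (n : ℕ) {F : Type*} [NormedAddCommGroup F] [NormedSpace ℂ F] :
    𝓢'(E n, F) →L[ℂ] 𝓢'(E n, F) :=
  PointwiseConvergenceCLM.precomp F (fourierSchwartz n)

theorem fourierTempered_apply (n : ℕ) {F : Type*} [NormedAddCommGroup F] [NormedSpace ℂ F]
    (T : 𝓢'(E n, F)) (φ : 𝓢(E n, ℂ)) :
    fourierTempered n T φ = T (fourierSchwartz n φ) := rfl

/-! ### Clifford multiplication -/

/-- The quadratic form `x ↦ -⟨x, x⟩` on `ℝⁿ`; in its Clifford algebra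
`x · y + y · x = -2⟨x, y⟩`. -/
def cliffordForm (n : ℕ) : QuadraticForm ℝ (E n) :=
  -(LinearMap.BilinMap.toQuadraticMap (innerₗ (E n)))

theorem cliffordForm_apply (n : ℕ) (x : E n) : cliffordForm n x = -‖x‖ ^ 2 := by
  simp [cliffordForm]

variable {n : ℕ} {S : Type*} [NormedAddCommGroup S] [NormedSpace ℂ S] [FiniteDimensional ℂ S]

/-- Clifford multiplication `ψ ↦ x · ψ` by a vector `x ∈ ℝⁿ` on a finite-dimensional complex
representation `S` of the Clifford algebra, as an element of `End_ℂ(S)` (linear maps on `S` are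
automatically continuous). -/
def cliffordMul (ρ : CliffordAlgebra (cliffordForm n) →ₐ[ℝ] Module.End ℂ S) (x : E n) :
    S →L[ℂ] S :=
  LinearMap.toContinuousLinearMap (ρ (CliffordAlgebra.ι (cliffordForm n) x))

theorem cliffordMul_relation (ρ : CliffordAlgebra (cliffordForm n) →ₐ[ℝ] Module.End ℂ S)
    (x y : E n) (ψ : S) :
    cliffordMul ρ x (cliffordMul ρ y ψ) + cliffordMul ρ y (cliffordMul ρ x ψ)
      = (-2 * inner ℝ x y : ℝ) • ψ := by
  have h := congrArg (fun a => ρ a ψ) (CliffordAlgebra.ι_mul_ι_add_swap (Q := cliffordForm n) x y)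
  have h2 : QuadraticMap.polar (cliffordForm n) x y = -2 * inner ℝ x y := by
    simp only [QuadraticMap.polar, cliffordForm_apply, norm_add_sq_real]
    ring
  simpa [cliffordMul, h2, Algebra.algebraMap_eq_smul_one] using h

/-! ### The Riesz distribution for spinors -/

/-- The `End(S)`-valued function `|x|^{s-1} x ·` on `ℝⁿ`. -/
def rieszKernel (ρ : CliffordAlgebra (cliffordForm n) →ₐ[ℝ] Module.End ℂ S) (s : ℂ) (x : E n) :
    S →L[ℂ] S :=
  ((‖x‖ : ℂ) ^ (s - 1)) • cliffordMul ρ x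

/-- The pole set `{-n-1-2k : k ∈ ℕ₀}`. -/
def rieszPoles (n : ℕ) : Set ℂ := {s | ∃ k : ℕ, s = -(n : ℂ) - 1 - 2 * k}

/-- `R` is the meromorphic continuation to `ℂ`, as a family of `End(S)`-valued tempered
distributions, of the family of locally integrable functions `|x|^{s-1} x ·` with `Re s > -n`:
it is given by integration against that function for `Re s > -n`, it is meromorphic on `ℂ` and
analytic away from `{-n-1-2k : k ∈ ℕ₀}` after pairing with any test function. The (meaningless)
values at the poles are set to `0`, so that `R` is unique. -/
structure IsRieszSpinor (ρ : CliffordAlgebra (cliffordForm n) →ₐ[ℝ] Module.End ℂ S)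
    (R : ℂ → 𝓢'(E n, S →L[ℂ] S)) : Prop where
  integrable : ∀ s : ℂ, -(n : ℝ) < s.re → ∀ φ : 𝓢(E n, ℂ),
    Integrable (fun x => φ x • rieszKernel ρ s x)
  eq_integral : ∀ s : ℂ, -(n : ℝ) < s.re → ∀ φ : 𝓢(E n, ℂ),
    R s φ = ∫ x, φ x • rieszKernel ρ s x
  analyticAt : ∀ φ : 𝓢(E n, ℂ), ∀ s ∉ rieszPoles n, AnalyticAt ℂ (fun z => R z φ) s
  meromorphicAt : ∀ φ : 𝓢(E n, ℂ), ∀ s : ℂ, MeromorphicAt (fun z => R z φ) s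
  eq_zero : ∀ s ∈ rieszPoles n, R s = 0

/-- The meromorphic continuation is unique. -/
theorem IsRieszSpinor.unique {ρ : CliffordAlgebra (cliffordForm n) →ₐ[ℝ] Module.End ℂ S}
    {R R' : ℂ → 𝓢'(E n, S →L[ℂ] S)} (h : IsRieszSpinor ρ R) (h' : IsRieszSpinor ρ R') :
    R = R' := by
  have hc : (rieszPoles n).Countable := by
    refine (Set.countable_range fun k : ℕ => -(n : ℂ) - 1 - 2 * k).mono ?_
    rintro s ⟨k, rfl⟩
    exact ⟨k, rfl⟩
  have hconn : IsPreconnected (rieszPoles n)ᶜ :=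
    (hc.isConnected_compl_of_one_lt_rank (by simp [Complex.rank_real_complex])).isPreconnected
  have h1 : (1 : ℂ) ∈ (rieszPoles n)ᶜ := by
    rintro ⟨k, hk⟩
    have := congrArg Complex.re hk
    simp at this
    have h2 : (0 : ℝ) ≤ n := n.cast_nonneg
    have h3 : (0 : ℝ) ≤ k := k.cast_nonneg
    linarith
  funext s
  by_cases hs : s ∈ rieszPoles n
  · rw [h.eq_zero s hs, h'.eq_zero s hs]
  ext φ : 1
  refine AnalyticOnNhd.eqOn_of_preconnected_of_eventuallyEq
    (f := fun z => R z φ) (g := fun z => R' z φ) (h.analyticAt φ) (h'.analyticAt φ) hconn h1 ?_ hs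
  have : ∀ᶠ z : ℂ in 𝓝 1, -(n : ℝ) < z.re := by
    refine Complex.continuous_re.continuousAt.eventually_const_lt ?_
    have h2 : (0 : ℝ) ≤ n := n.cast_nonneg
    simp only [Complex.one_re]
    linarith
  filter_upwards [this] with z hz
  rw [h.eq_integral z hz φ, h'.eq_integral z hz φ]

/-- The Riesz distribution for spinors `s ↦ |x|^{s-1} x ·`: the meromorphic continuation in the
sense of `IsRieszSpinor`. -/
def rieszSpinor (ρ : CliffordAlgebra (cliffordForm n) →ₐ[ℝ] Module.End ℂ S) :
    ℂ → 𝓢'(E n, S →L[ℂ] S) :=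
  Classical.epsilon (IsRieszSpinor ρ)

/-! ### The constants -/

/-- `c_s = 2^{s+n} π^{n/2} Γ((s+n)/2) Γ(-s/2)⁻¹`. (At the poles of the second factor `Γ`, Mathlib's
`Γ` is `0`, hence so is its inverse there, which is the value of the entire function `1/Γ`.) -/
def cConst (n : ℕ) (s : ℂ) : ℂ :=
  (2 : ℂ) ^ (s + n) * (Real.pi : ℂ) ^ ((n : ℂ) / 2) * Complex.Gamma ((s + n) / 2)
    * (Complex.Gamma (-s / 2))⁻¹

/-- `-i c_{s+1} / (s+1)`. The singularity at `s = -1` is removable. -/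
def cSlash (n : ℕ) (s : ℂ) : ℂ := -Complex.I * (cConst n (s + 1) / (s + 1))

end SpinorRiesz

end

/-!
Clifford multiplication is linear, so `|x|^{s-1} x ·` is the sum over the standard basis of the
scalar functions `|x|^{s-1} ⟨eᵢ, x⟩` times fixed endomorphisms, and everything reduces to the scalar
distributions `T_s(φ) = ∫ φ(x) |x|^{s-1} ⟨v, x⟩ dx` (`oddRiesz`), defined for `Re s > -n`.

The heart is the functional equation in the strip `-n < Re s < 0`, proved as for theta series. Write
`G_φ(t) = ∫ φ(x) ⟨v, x⟩ e^{-t|x|²} dx` (`gaussianPairing`). Subordination of powers to Gaussians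
gives `∫ t^{u-1} G_φ(t) dt = Γ(u) T_s(φ)` with `u = (1-s)/2` (`mellin_gaussianPairing`), while the
explicit Fourier transform of `⟨v, x⟩ e^{-t|x|²}` gives
`G_{𝓕φ}(t) = (i/2t) (π/t)^{n/2} G_φ(1/(4t))` (`gaussianPairing_fourierSchwartz`). The substitution
`t ↦ 1/(4t)` exchanges `s` and `-s-n`, and `T_s(𝓕φ) = c(s) T_{-s-n}(φ)` follows
(`oddRiesz_fourierSchwartz`), where `c` (`cReg`) is `cSlash` with its singularity at `-1` removed.

The functional equation also supplies the meromorphic continuation. Since `𝓕𝓕` is `(2π)ⁿ` times the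
reflection `x ↦ -x` and the kernel is odd, it can be solved for `T_s = -(2π)⁻ⁿ c(s) 𝓕 T_{-s-n}`,
whose right-hand side makes sense for all `Re s < 0`; its only singularities are the poles of
`Γ((s+n+1)/2)`. For `n ≥ 1` the half-planes `Re s > -n` and `Re s < 0` cover the plane
(`oddRieszCont`). With `c(s) c(-s-n) = -(2π)ⁿ` (`cReg_mul_cReg`) the functional equation then holds
wherever both sides are regular, and the limit statement is continuity of the left-hand side. For
`n = 0` all distributions vanish.
-/

namespace SpinorRiesz

noncomputable section

variable {n : ℕ}

/-! ### Powers of the norm as weights -/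

theorem integrable_norm_rpow_mul [NeZero n] {a : ℝ} (ha : -(n : ℝ) < a) {N : ℕ}
    (hN : a + n < N) :
    Integrable (fun x : E n => ((1 + ‖x‖) ^ N)⁻¹ * ‖x‖ ^ a) := by
  rw [integrable_fun_norm_addHaar volume (f := fun y : ℝ => ((1 + y) ^ N)⁻¹ * y ^ a)]
  simp only [finrank_euclideanSpace, Fintype.card_fin, smul_eq_mul]
  have hn : 1 ≤ n := NeZero.one_le
  have key : ∀ y : ℝ, 0 < y → y ^ (n - 1) * y ^ a = y ^ (a + n - 1) := by
    intro y hy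
    rw [← Real.rpow_natCast, ← Real.rpow_add hy]
    congr 1
    push_cast [hn]
    ring
  have hmeas : Measurable (fun y : ℝ => y ^ (n - 1) * (((1 + y) ^ N)⁻¹ * y ^ a)) := by fun_prop
  rw [← Set.Ioc_union_Ioi_eq_Ioi (zero_le_one' ℝ), integrableOn_union]
  constructor
  · have h := (intervalIntegral.intervalIntegrable_rpow' (a := 0) (b := 1)
      (r := a + n - 1) (by linarith)).1
    refine h.mono' hmeas.aestronglyMeasurable ?_
    filter_upwards [ae_restrict_mem measurableSet_Ioc] with y hy
    have hy0 : 0 < y := hy.1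
    have h1 : ((1 + y) ^ N)⁻¹ ≤ 1 := inv_le_one_of_one_le₀ (one_le_pow₀ (by linarith))
    rw [Real.norm_of_nonneg (by positivity), ← key y hy0]
    gcongr
    exact mul_le_of_le_one_left (by positivity) h1
  · have h := integrableOn_Ioi_rpow_of_lt (a := a + n - 1 - N) (by linarith) (zero_lt_one' ℝ)
    refine h.mono' hmeas.aestronglyMeasurable ?_
    filter_upwards [ae_restrict_mem measurableSet_Ioi] with y hy
    have hy0 : 0 < y := zero_lt_one.trans hy
    have h1 : ((1 + y) ^ N)⁻¹ ≤ (y ^ N)⁻¹ := by gcongr; linarith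
    rw [Real.norm_of_nonneg (by positivity), Real.rpow_sub hy0, ← key y hy0, Real.rpow_natCast]
    calc y ^ (n - 1) * (((1 + y) ^ N)⁻¹ * y ^ a) ≤ y ^ (n - 1) * ((y ^ N)⁻¹ * y ^ a) := by gcongr
      _ = _ := by ring

theorem exists_integrable_norm_rpow_mul [NeZero n] {a : ℝ} (ha : -(n : ℝ) < a) :
    ∃ N : ℕ, Integrable (fun x : E n => ((1 + ‖x‖) ^ N)⁻¹ * ‖x‖ ^ a) := by
  obtain ⟨N, hN⟩ := exists_nat_gt (a + n)
  exact ⟨N, integrable_norm_rpow_mul ha hN⟩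

/-- A Schwartz function is bounded by a Schwartz seminorm times `(1 + ‖x‖)⁻ᴺ`. -/
theorem norm_schwartz_le (φ : 𝓢(E n, ℂ)) (N : ℕ) (x : E n) :
    ‖φ x‖ ≤ (2 ^ N * ((Finset.Iic (N, 0)).sup (schwartzSeminormFamily ℂ (E n) ℂ)) φ) *
      ((1 + ‖x‖) ^ N)⁻¹ := by
  rw [← div_eq_mul_inv, le_div_iff₀' (by positivity)]
  simpa using! one_add_le_sup_seminorm_apply (𝕜 := ℂ) (m := (N, 0)) (k := N) (n := 0)
    le_rfl le_rfl φ x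

theorem integrable_schwartz_mul_norm_rpow [NeZero n] {a : ℝ} (ha : -(n : ℝ) < a)
    (φ : 𝓢(E n, ℂ)) : Integrable (fun x : E n => ‖φ x‖ * ‖x‖ ^ a) := by
  obtain ⟨N, hN⟩ := exists_integrable_norm_rpow_mul ha
  refine (hN.const_mul
    (2 ^ N * ((Finset.Iic (N, 0)).sup (schwartzSeminormFamily ℂ (E n) ℂ)) φ)).mono' ?_ ?_
  · have := φ.continuous.measurable
    exact Measurable.aestronglyMeasurable (by fun_prop)
  · refine Eventually.of_forall fun x => ?_
    rw [Real.norm_of_nonneg (by positivity), ← mul_assoc]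
    gcongr
    exact norm_schwartz_le φ N x

/-! ### The scalar distributions `|x|^{s-1} ⟨v, x⟩` -/

/-- The function `|x|^{s-1} ⟨v, x⟩`, the component of `rieszKernel` in the direction `v`. -/
def oddKernel (v : E n) (s : ℂ) (x : E n) : ℂ :=
  (‖x‖ : ℂ) ^ (s - 1) * (inner ℝ v x : ℝ)

theorem measurable_oddKernel (v : E n) (s : ℂ) : Measurable (oddKernel v s) := by
  unfold oddKernel
  fun_prop

theorem oddKernel_zero (v : E n) (s : ℂ) : oddKernel v s 0 = 0 := by simp [oddKernel]

theorem oddKernel_neg (v : E n) (s : ℂ) (x : E n) : oddKernel v s (-x) = -oddKernel v s x := by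
  simp [oddKernel]

theorem norm_oddKernel_le (v : E n) (s : ℂ) (x : E n) :
    ‖oddKernel v s x‖ ≤ ‖v‖ * ‖x‖ ^ s.re := by
  rcases eq_or_ne x 0 with rfl | hx
  · rw [oddKernel_zero, norm_zero]; positivity
  have hx' : 0 < ‖x‖ := norm_pos_iff.mpr hx
  rw [oddKernel, norm_mul, Complex.norm_cpow_eq_rpow_re_of_pos hx', Complex.norm_real,
    Real.norm_eq_abs]
  calc ‖x‖ ^ (s - 1).re * |inner ℝ v x| ≤ ‖x‖ ^ (s - 1).re * (‖v‖ * ‖x‖) := by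
        gcongr
        exact abs_real_inner_le_norm v x
    _ = ‖v‖ * ‖x‖ ^ s.re := by
        rw [Complex.sub_re, Complex.one_re, Real.rpow_sub_one hx'.ne']
        field_simp

theorem integrable_mul_oddKernel [NeZero n] (v : E n) {s : ℂ} (hs : -(n : ℝ) < s.re)
    (φ : 𝓢(E n, ℂ)) : Integrable (fun x => φ x * oddKernel v s x) := by
  refine ((integrable_schwartz_mul_norm_rpow hs φ).const_mul ‖v‖).mono' ?_ ?_
  · exact (φ.continuous.measurable.mul (measurable_oddKernel v s)).aestronglyMeasurable
  · refine Eventually.of_forall fun x => ?_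
    rw [norm_mul]
    calc ‖φ x‖ * ‖oddKernel v s x‖ ≤ ‖φ x‖ * (‖v‖ * ‖x‖ ^ s.re) := by
          gcongr
          exact norm_oddKernel_le v s x
      _ = _ := by ring

/-- Integration against `|x|^{s-1} ⟨v, x⟩`, as a continuous functional on Schwartz functions. -/
def oddRiesz [NeZero n] (v : E n) (s : ℂ) (hs : -(n : ℝ) < s.re) : 𝓢(E n, ℂ) →L[ℂ] ℂ :=
  mkCLMtoNormedSpace (fun φ => ∫ x, φ x * oddKernel v s x)
    (fun φ ψ => by
      simp only [add_apply, add_mul]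
      exact integral_add (integrable_mul_oddKernel v hs φ) (integrable_mul_oddKernel v hs ψ))
    (fun c φ => by
      simp only [smul_apply, smul_eq_mul, mul_assoc, RingHom.id_apply]
      exact integral_const_mul _ _)
    (by
      obtain ⟨N, hN⟩ := exists_integrable_norm_rpow_mul hs
      refine ⟨Finset.Iic (N, 0), 2 ^ N * ‖v‖ * ∫ x : E n, ((1 + ‖x‖) ^ N)⁻¹ * ‖x‖ ^ s.re,
        mul_nonneg (by positivity) (integral_nonneg fun x => by positivity), fun φ => ?_⟩
      refine (norm_integral_le_of_norm_le (hN.const_mul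
        (2 ^ N * ((Finset.Iic (N, 0)).sup (schwartzSeminormFamily ℂ (E n) ℂ)) φ * ‖v‖))
        (Eventually.of_forall fun x => ?_)).trans_eq ?_
      · rw [norm_mul]
        refine (mul_le_mul (norm_schwartz_le φ N x) (norm_oddKernel_le v s x) (norm_nonneg _)
          (by positivity)).trans_eq ?_
        ring
      · rw [integral_const_mul]
        ring)

theorem oddRiesz_apply [NeZero n] (v : E n) (s : ℂ) (hs : -(n : ℝ) < s.re) (φ : 𝓢(E n, ℂ)) :
    oddRiesz v s hs φ = ∫ x, φ x * oddKernel v s x := rfl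

/-- The logarithm costs an arbitrarily small power, so that the derivative of `s ↦ r ^ s` is
bounded near `a`, uniformly in `r`, by powers with exponents near `a`. -/
theorem rpow_mul_abs_log_le {r a b ε : ℝ} (hr : 0 < r) (hε : 0 < ε) (hb : |b - a| ≤ ε) :
    r ^ b * |Real.log r| ≤ ε⁻¹ * (r ^ (a + 2 * ε) + r ^ (a - 2 * ε)) := by
  obtain ⟨h1, h2⟩ := abs_le.mp hb
  rcases le_total 1 r with h | h
  · have hl : |Real.log r| ≤ r ^ ε / ε := by
      rw [abs_of_nonneg (Real.log_nonneg h)]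
      exact Real.log_le_rpow_div hr.le hε
    calc r ^ b * |Real.log r| ≤ r ^ (a + ε) * (r ^ ε / ε) := by
          gcongr
          linarith
      _ = ε⁻¹ * r ^ (a + 2 * ε) := by
          rw [mul_div_assoc', ← Real.rpow_add hr, div_eq_inv_mul]
          ring_nf
      _ ≤ _ := by gcongr; linarith [Real.rpow_nonneg hr.le (a - 2 * ε)]
  · have hl : |Real.log r| ≤ r ^ (-ε) / ε := by
      rw [abs_of_nonpos (Real.log_nonpos hr.le h), ← Real.log_inv, Real.rpow_neg hr.le,
        ← Real.inv_rpow hr.le]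
      exact Real.log_le_rpow_div (inv_nonneg.mpr hr.le) hε
    calc r ^ b * |Real.log r| ≤ r ^ (a - ε) * (r ^ (-ε) / ε) :=
          mul_le_mul (Real.rpow_le_rpow_of_exponent_ge hr h (by linarith)) hl (abs_nonneg _)
            (by positivity)
      _ = ε⁻¹ * r ^ (a - 2 * ε) := by
          rw [mul_div_assoc', ← Real.rpow_add hr, div_eq_inv_mul]
          ring_nf
      _ ≤ _ := by gcongr; linarith [Real.rpow_nonneg hr.le (a + 2 * ε)]

theorem hasDerivAt_oddKernel (v : E n) (s : ℂ) (x : E n) :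
    HasDerivAt (fun z => oddKernel v z x) (oddKernel v s x * Real.log ‖x‖) s := by
  rcases eq_or_ne x 0 with rfl | hx
  · simpa [oddKernel_zero] using hasDerivAt_const s (0 : ℂ)
  have hx' : (‖x‖ : ℂ) ≠ 0 := by simpa using hx
  have h := (((hasDerivAt_id s).sub_const 1).const_cpow (c := (‖x‖ : ℂ)) (Or.inl hx')).mul_const
    ((inner ℝ v x : ℝ) : ℂ)
  convert! h using 1
  rw [oddKernel, Complex.ofReal_log (norm_nonneg x)]
  simp only [id]
  ring

theorem differentiableAt_integral_mul_oddKernel [NeZero n] (v : E n) {s : ℂ}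
    (hs : -(n : ℝ) < s.re) (φ : 𝓢(E n, ℂ)) :
    DifferentiableAt ℂ (fun z => ∫ x, φ x * oddKernel v z x) s := by
  obtain ⟨ε, hε, hε'⟩ : ∃ ε : ℝ, 0 < ε ∧ -(n : ℝ) < s.re - 2 * ε :=
    ⟨(s.re + n) / 4, by linarith, by linarith⟩
  have hplus := integrable_schwartz_mul_norm_rpow (a := s.re + 2 * ε) (by linarith) φ
  have hminus := integrable_schwartz_mul_norm_rpow hε' φ
  have hφ := φ.continuous.measurable
  refine (hasDerivAt_integral_of_dominated_loc_of_deriv_le (Metric.ball_mem_nhds s hε)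
    (F' := fun z x => φ x * (oddKernel v z x * Real.log ‖x‖))
    (bound := fun x => ‖v‖ * ε⁻¹ * (‖φ x‖ * ‖x‖ ^ (s.re + 2 * ε) + ‖φ x‖ * ‖x‖ ^ (s.re - 2 * ε)))
    ?_ (integrable_mul_oddKernel v hs φ) ?_ ?_ ((hplus.add hminus).const_mul _)
    ?_).2.differentiableAt
  · exact Eventually.of_forall fun z => (hφ.mul (measurable_oddKernel v z)).aestronglyMeasurable
  · have := measurable_oddKernel v s
    exact Measurable.aestronglyMeasurable (by fun_prop)
  · refine Eventually.of_forall fun x z hz => ?_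
    rcases eq_or_ne x 0 with rfl | hx
    · rw [oddKernel_zero, zero_mul, mul_zero, norm_zero]
      positivity
    have hzs : |z.re - s.re| ≤ ε := by
      rw [← Complex.sub_re]
      exact (Complex.abs_re_le_norm _).trans (mem_ball_iff_norm.mp hz).le
    rw [norm_mul, norm_mul, Complex.norm_real, Real.norm_eq_abs]
    calc ‖φ x‖ * (‖oddKernel v z x‖ * |Real.log ‖x‖|)
        ≤ ‖φ x‖ * ((‖v‖ * ‖x‖ ^ z.re) * |Real.log ‖x‖|) := by
          gcongr
          exact norm_oddKernel_le v z x
      _ = ‖φ x‖ * (‖v‖ * (‖x‖ ^ z.re * |Real.log ‖x‖|)) := by ring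
      _ ≤ ‖φ x‖ * (‖v‖ * (ε⁻¹ * (‖x‖ ^ (s.re + 2 * ε) + ‖x‖ ^ (s.re - 2 * ε)))) := by
          have := rpow_mul_abs_log_le (norm_pos_iff.mpr hx) hε hzs
          gcongr ‖φ x‖ * (‖v‖ * ?_)
      _ = _ := by ring
  · exact Eventually.of_forall fun x z _ => (hasDerivAt_oddKernel v z x).const_mul (φ x)

/-! ### Odd Gaussians -/

/-- The odd Gaussian `⟨v, x⟩ e^{-t|x|²}`. -/
def oddGaussian (v : E n) (t : ℝ) (x : E n) : ℂ :=
  (inner ℝ v x : ℝ) * Complex.exp (-t * (‖x‖ : ℂ) ^ 2)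

theorem continuous_oddGaussian (v : E n) : Continuous (Function.uncurry (oddGaussian v)) := by
  unfold oddGaussian Function.uncurry
  fun_prop

theorem norm_oddGaussian (v : E n) (t : ℝ) (x : E n) :
    ‖oddGaussian v t x‖ = |inner ℝ v x| * Real.exp (-t * ‖x‖ ^ 2) := by
  rw [oddGaussian, norm_mul, Complex.norm_real, Real.norm_eq_abs, Complex.norm_exp]
  congr 2
  norm_cast

theorem integrable_gaussian {t : ℝ} (ht : 0 < t) :
    Integrable (fun x : E n => Real.exp (-t * ‖x‖ ^ 2)) := by
  have h := (GaussianFourier.integrable_cexp_neg_mul_sq_norm_add (V := E n) (b := (t : ℂ))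
    (by simpa using ht) 0 0).norm
  refine h.congr (Eventually.of_forall fun x => ?_)
  simp only [Complex.norm_exp]
  congr 1
  norm_cast
  simp

theorem integrable_oddGaussian (v : E n) {t : ℝ} (ht : 0 < t) :
    Integrable (oddGaussian v t) := by
  refine ((integrable_gaussian (n := n) (half_pos ht)).const_mul
    (‖v‖ * (1 + (2 * t)⁻¹))).mono' ?_ ?_
  · exact ((continuous_oddGaussian v).comp (Continuous.prodMk_right t)).aestronglyMeasurable
  · refine Eventually.of_forall fun x => ?_
    rw [norm_oddGaussian]
    have h1 : ‖x‖ ≤ (1 + (2 * t)⁻¹) * (t / 2 * ‖x‖ ^ 2 + 1) := by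
      have : (2 * t)⁻¹ * (2 * t) = 1 := inv_mul_cancel₀ (by positivity)
      have h2 : 0 < (2 * t)⁻¹ := by positivity
      -- `‖x‖ ≤ (t / 2) ‖x‖ ^ 2 + (2 t)⁻¹` by the inequality of means
      have h3 : 0 ≤ (2 * t)⁻¹ * (t * ‖x‖ - 1) ^ 2 := by positivity
      nlinarith [sq_nonneg ‖x‖, mul_nonneg h2.le (mul_nonneg ht.le (sq_nonneg ‖x‖))]
    have h2 : ‖x‖ ≤ (1 + (2 * t)⁻¹) * Real.exp (t / 2 * ‖x‖ ^ 2) :=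
      h1.trans (by gcongr; exact Real.add_one_le_exp _)
    calc |inner ℝ v x| * Real.exp (-t * ‖x‖ ^ 2)
        ≤ (‖v‖ * ((1 + (2 * t)⁻¹) * Real.exp (t / 2 * ‖x‖ ^ 2))) * Real.exp (-t * ‖x‖ ^ 2) := by
          gcongr
          exact (abs_real_inner_le_norm v x).trans (by gcongr)
      _ = ‖v‖ * (1 + (2 * t)⁻¹) * (Real.exp (t / 2 * ‖x‖ ^ 2) * Real.exp (-t * ‖x‖ ^ 2)) := by
          ring
      _ = _ := by
          rw [← Real.exp_add]
          ring_nf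

/-- The Fourier transform of an odd Gaussian, obtained by integrating the derivative of
`e^{-t|ξ|² + i⟨x, ξ⟩}` in the direction `v`. -/
theorem integral_oddGaussian_mul_cexp (v : E n) {t : ℝ} (ht : 0 < t) (x : E n) :
    ∫ ξ, Complex.exp (Complex.I * (inner ℝ x ξ : ℝ)) * oddGaussian v t ξ =
      Complex.I / (2 * t) * (Real.pi / t : ℂ) ^ ((n : ℂ) / 2) * oddGaussian v (1 / (4 * t)) x := by
  set f : E n → ℂ := fun ξ => Complex.exp (-t * (‖ξ‖ : ℂ) ^ 2 + Complex.I * (inner ℝ x ξ : ℝ))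
    with hf
  have hre : 0 < (t : ℂ).re := by simpa using ht
  have hfint : Integrable f :=
    GaussianFourier.integrable_cexp_neg_mul_sq_norm_add (V := E n) hre Complex.I x
  have hfval : ∫ ξ, f ξ = (Real.pi / t : ℂ) ^ ((n : ℂ) / 2) *
      Complex.exp (-(1 / (4 * t) : ℝ) * (‖x‖ : ℂ) ^ 2) := by
    rw [hf, GaussianFourier.integral_cexp_neg_mul_sq_norm_add (V := E n) hre Complex.I x,
      finrank_euclideanSpace, Fintype.card_fin, Complex.I_sq]
    congr 2
    push_cast
    ring
  have hgf : ∀ ξ, Complex.exp (Complex.I * (inner ℝ x ξ : ℝ)) * oddGaussian v t ξ =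
      (inner ℝ v ξ : ℝ) * f ξ := by
    intro ξ
    simp only [hf, oddGaussian, Complex.exp_add]
    ring
  have hgint : Integrable (fun ξ => ((inner ℝ v ξ : ℝ) : ℂ) * f ξ) := by
    simp_rw [← hgf]
    refine (integrable_oddGaussian v ht).bdd_mul (c := 1)
      (Continuous.aestronglyMeasurable (by fun_prop)) (Eventually.of_forall fun ξ => ?_)
    rw [mul_comm, Complex.norm_exp_ofReal_mul_I]
  have hderiv : ∀ ξ, HasLineDerivAt ℝ f
      (-2 * t * ((inner ℝ v ξ : ℝ) * f ξ) + Complex.I * (inner ℝ x v : ℝ) * f ξ) ξ v := by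
    intro ξ
    have h1 : HasDerivAt (fun r : ℝ => ξ + r • v) v 0 := by
      simpa using ((hasDerivAt_id (0 : ℝ)).smul_const v).const_add ξ
    have h2 : HasDerivAt (fun r : ℝ => ‖ξ + r • v‖ ^ 2) (2 * inner ℝ ξ v) 0 := by
      simpa using h1.norm_sq
    have h3 : HasDerivAt (fun r : ℝ => inner ℝ x (ξ + r • v)) (inner ℝ x v) 0 := by
      simpa using (hasDerivAt_const (0 : ℝ) x).inner ℝ h1
    have h4 := ((h2.ofReal_comp.const_mul (-t : ℂ)).add
      (h3.ofReal_comp.const_mul Complex.I)).cexp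
    unfold HasLineDerivAt
    convert! h4 using 1
    · funext r
      simp [hf]
    · simp only [hf, zero_smul, add_zero, real_inner_comm v ξ, Pi.add_apply]
      push_cast
      ring
  have hzero := integral_bilinear_hasLineDerivAt_right_eq_neg_left_of_integrable
    (μ := volume) (f := fun _ : E n => (1 : ℂ)) (f' := fun _ => 0) (g := f) (v := v)
    (g' := fun ξ => -2 * t * ((inner ℝ v ξ : ℝ) * f ξ) + Complex.I * (inner ℝ x v : ℝ) * f ξ)
    (B := ContinuousLinearMap.mul ℝ ℂ) (by simp)
    (by simpa only [ContinuousLinearMap.mul_apply', one_mul] using!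
      (hgint.const_mul (-2 * t : ℂ)).add (hfint.const_mul _))
    (by simpa using hfint) (fun ξ _ => (hasFDerivAt_const (1 : ℂ) ξ).hasLineDerivAt v)
    (fun ξ _ => hderiv ξ)
  simp only [ContinuousLinearMap.mul_apply', one_mul, zero_mul, integral_zero, neg_zero] at hzero
  rw [integral_add (hgint.const_mul _) (hfint.const_mul _), integral_const_mul,
    integral_const_mul, hfval] at hzero
  simp_rw [hgf]
  have ht' : (t : ℂ) ≠ 0 := by exact_mod_cast ht.ne'
  rw [oddGaussian, real_inner_comm x v, div_mul_eq_mul_div, div_mul_eq_mul_div,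
    eq_div_iff (by simpa using ht')]
  linear_combination (-1 : ℂ) * hzero

/-! ### Pairing with odd Gaussians and the Mellin transform -/

/-- The pairing of a test function with the odd Gaussians, as a function of the parameter. -/
def gaussianPairing (v : E n) (φ : 𝓢(E n, ℂ)) (t : ℝ) : ℂ :=
  ∫ x, φ x * oddGaussian v t x

theorem gaussianPairing_fourierSchwartz (v : E n) (φ : 𝓢(E n, ℂ)) {t : ℝ} (ht : 0 < t) :
    gaussianPairing v (fourierSchwartz n φ) t =
      Complex.I / (2 * t) * (Real.pi / t : ℂ) ^ ((n : ℂ) / 2) *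
        gaussianPairing v φ (1 / (4 * t)) := by
  have hint : Integrable (Function.uncurry fun ξ x : E n =>
      φ x * Complex.exp (Complex.I * (inner ℝ x ξ : ℝ)) * oddGaussian v t ξ)
      (volume.prod volume) := by
    have h := ((integrable_oddGaussian v ht).mul_prod (φ.integrable (μ := volume))).bdd_mul (c := 1)
      (f := fun p : E n × E n => Complex.exp (Complex.I * (inner ℝ p.2 p.1 : ℝ)))
      (Continuous.aestronglyMeasurable (by fun_prop)) (Eventually.of_forall fun p => by
        rw [mul_comm, Complex.norm_exp_ofReal_mul_I])
    refine h.congr (Eventually.of_forall fun p => ?_)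
    simp only [Function.uncurry]
    ring
  calc gaussianPairing v (fourierSchwartz n φ) t
      = ∫ ξ, ∫ x, φ x * Complex.exp (Complex.I * (inner ℝ x ξ : ℝ)) * oddGaussian v t ξ := by
        simp only [gaussianPairing, fourierSchwartz_apply, integral_mul_const]
    _ = ∫ x, ∫ ξ, φ x * Complex.exp (Complex.I * (inner ℝ x ξ : ℝ)) * oddGaussian v t ξ :=
        integral_integral_swap hint
    _ = ∫ x, Complex.I / (2 * t) * (Real.pi / t : ℂ) ^ ((n : ℂ) / 2) *
          (φ x * oddGaussian v (1 / (4 * t)) x) := by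
        congr 1
        funext x
        simp only [mul_assoc (φ x), integral_const_mul, integral_oddGaussian_mul_cexp v ht]
        ring
    _ = _ := integral_const_mul _ _

theorem integral_cpow_mul_oddGaussian (v x : E n) {s : ℂ} (hs : s.re < 1) :
    ∫ t in Set.Ioi (0 : ℝ), (t : ℂ) ^ ((1 - s) / 2 - 1) * oddGaussian v t x =
      Complex.Gamma ((1 - s) / 2) * oddKernel v s x := by
  rcases eq_or_ne x 0 with rfl | hx
  · simp [oddGaussian, oddKernel_zero]
  have hx' : 0 < ‖x‖ := norm_pos_iff.mpr hx
  have hre : 0 < ((1 - s) / 2).re := by simpa using hs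
  have h := Complex.integral_cpow_mul_exp_neg_mul_Ioi hre (pow_pos hx' 2)
  have h2 : ∀ t : ℝ, (t : ℂ) ^ ((1 - s) / 2 - 1) * oddGaussian v t x =
      (inner ℝ v x : ℝ) *
        ((t : ℂ) ^ ((1 - s) / 2 - 1) * Complex.exp (-(((‖x‖ ^ 2 : ℝ) : ℂ) * t))) := by
    intro t
    rw [oddGaussian, show -(t : ℂ) * (‖x‖ : ℂ) ^ 2 = -(((‖x‖ ^ 2 : ℝ) : ℂ) * t) by
      push_cast; ring]
    ring
  simp_rw [h2]
  rw [integral_const_mul, h, oddKernel]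
  have h3 : (1 / ((‖x‖ ^ 2 : ℝ) : ℂ)) ^ ((1 - s) / 2) = (‖x‖ : ℂ) ^ (s - 1) := by
    have hne : (‖x‖ : ℂ) ≠ 0 := by exact_mod_cast hx'.ne'
    rw [← Complex.ofReal_one, ← Complex.ofReal_div,
      Complex.cpow_def_of_ne_zero (by exact_mod_cast (by positivity : 1 / ‖x‖ ^ 2 ≠ 0)),
      Complex.cpow_def_of_ne_zero hne, ← Complex.ofReal_log (by positivity),
      ← Complex.ofReal_log hx'.le, one_div, Real.log_inv, Real.log_pow]
    congr 1
    push_cast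
    ring
  rw [h3]
  ring

theorem norm_cpow_mul_oddGaussian (v x : E n) (s : ℂ) {t : ℝ} (ht : 0 < t) :
    ‖(t : ℂ) ^ ((1 - s) / 2 - 1) * oddGaussian v t x‖ =
      |inner ℝ v x| * (t ^ ((1 - s.re) / 2 - 1) * Real.exp (-(‖x‖ ^ 2 * t))) := by
  rw [norm_mul, Complex.norm_cpow_eq_rpow_re_of_pos ht, norm_oddGaussian,
    show -t * ‖x‖ ^ 2 = -(‖x‖ ^ 2 * t) by ring]
  simp
  ring

theorem integrableOn_cpow_mul_oddGaussian (v x : E n) {s : ℂ} (hs : s.re < 1) :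
    IntegrableOn (fun t : ℝ => (t : ℂ) ^ ((1 - s) / 2 - 1) * oddGaussian v t x) (Set.Ioi 0) := by
  rcases eq_or_ne x 0 with rfl | hx
  · simp [oddGaussian]
  have hx' : 0 < ‖x‖ := norm_pos_iff.mpr hx
  have h := integrableOn_rpow_mul_exp_neg_mul_rpow (s := (1 - s.re) / 2 - 1) (p := 1)
    (b := ‖x‖ ^ 2) (by linarith) one_pos (by positivity)
  refine (h.const_mul |inner ℝ v x|).mono' ?_ ?_
  · have := (continuous_oddGaussian v).measurable.comp (measurable_prodMk_right (y := x))
    exact Measurable.aestronglyMeasurable (Measurable.mul (by fun_prop) this)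
  · filter_upwards [ae_restrict_mem measurableSet_Ioi] with t ht
    rw [norm_cpow_mul_oddGaussian v x s ht, Real.rpow_one, neg_mul]

theorem integral_norm_cpow_mul_oddGaussian (v x : E n) {s : ℂ} (hs : s.re < 1) :
    ∫ t in Set.Ioi (0 : ℝ), ‖(t : ℂ) ^ ((1 - s) / 2 - 1) * oddGaussian v t x‖ =
      Real.Gamma ((1 - s.re) / 2) * ‖oddKernel v s x‖ := by
  rcases eq_or_ne x 0 with rfl | hx
  · simp [oddGaussian, oddKernel_zero]
  have hx' : 0 < ‖x‖ := norm_pos_iff.mpr hx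
  rw [setIntegral_congr_fun measurableSet_Ioi fun t ht => norm_cpow_mul_oddGaussian v x s ht,
    integral_const_mul, Real.integral_rpow_mul_exp_neg_mul_Ioi (by linarith) (by positivity),
    oddKernel, norm_mul, Complex.norm_cpow_eq_rpow_re_of_pos hx', Complex.norm_real,
    Real.norm_eq_abs, one_div, ← Real.rpow_two, ← Real.rpow_neg hx'.le, ← Real.rpow_mul hx'.le]
  rw [show -2 * ((1 - s.re) / 2) = (s - 1).re by simp; ring]
  ring

/-- The subordination of powers to Gaussians, `Γ(u) |x|^{-2u} = ∫ t^{u-1} e^{-t|x|²} dt`, turns the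
pairing with `|x|^{s-1} ⟨v, x⟩` into a Mellin transform. -/
theorem mellin_gaussianPairing [NeZero n] (v : E n) (φ : 𝓢(E n, ℂ)) {s : ℂ}
    (hs : -(n : ℝ) < s.re) (hs1 : s.re < 1) :
    mellin (gaussianPairing v φ) ((1 - s) / 2) =
      Complex.Gamma ((1 - s) / 2) * oddRiesz v s hs φ := by
  have hmeas : Measurable (Function.uncurry fun (t : ℝ) (x : E n) =>
      (t : ℂ) ^ ((1 - s) / 2 - 1) * (φ x * oddGaussian v t x)) := by
    have h1 := (continuous_oddGaussian v).measurable
    have h2 := φ.continuous.measurable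
    exact Measurable.mul (by fun_prop) ((h2.comp measurable_snd).mul h1)
  have hrw : ∀ (t : ℝ) (x : E n), (t : ℂ) ^ ((1 - s) / 2 - 1) * (φ x * oddGaussian v t x) =
      φ x * ((t : ℂ) ^ ((1 - s) / 2 - 1) * oddGaussian v t x) := fun t x => by ring
  have hint : Integrable (Function.uncurry fun (t : ℝ) (x : E n) =>
      (t : ℂ) ^ ((1 - s) / 2 - 1) * (φ x * oddGaussian v t x))
      ((volume.restrict (Set.Ioi 0)).prod volume) := by
    rw [integrable_prod_iff' hmeas.aestronglyMeasurable]
    constructor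
    · refine Eventually.of_forall fun x => ?_
      simp only [Function.uncurry, hrw]
      exact (integrableOn_cpow_mul_oddGaussian v x hs1).const_mul (φ x)
    · simp only [Function.uncurry, hrw]
      simp_rw [norm_mul (φ _), integral_const_mul, integral_norm_cpow_mul_oddGaussian v _ hs1]
      refine ((integrable_mul_oddKernel v hs φ).norm.const_mul
        (Real.Gamma ((1 - s.re) / 2))).congr (Eventually.of_forall fun x => ?_)
      simp only [norm_mul]
      ring
  calc mellin (gaussianPairing v φ) ((1 - s) / 2)
      = ∫ t in Set.Ioi (0 : ℝ), ∫ x, (t : ℂ) ^ ((1 - s) / 2 - 1) * (φ x * oddGaussian v t x) := by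
        simp only [mellin, gaussianPairing, smul_eq_mul, integral_const_mul]
    _ = ∫ x, ∫ t in Set.Ioi (0 : ℝ), (t : ℂ) ^ ((1 - s) / 2 - 1) * (φ x * oddGaussian v t x) :=
        integral_integral_swap hint
    _ = ∫ x, Complex.Gamma ((1 - s) / 2) * (φ x * oddKernel v s x) := by
        congr 1
        funext x
        simp only [hrw, integral_const_mul, integral_cpow_mul_oddGaussian v x hs1]
        ring
    _ = _ := by rw [integral_const_mul, oddRiesz_apply]

/-- The constant `i 2^{s+n} π^{n/2} Γ((s+n+1)/2) / Γ((1-s)/2)`, which is `cSlash` continued through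
its removable singularity at `s = -1`. At the poles of the first `Γ` the value is `0`. -/
def cReg (n : ℕ) (s : ℂ) : ℂ :=
  Complex.I * 2 ^ (s + n) * (Real.pi : ℂ) ^ ((n : ℂ) / 2) * Complex.Gamma ((s + n + 1) / 2) *
    (Complex.Gamma ((1 - s) / 2))⁻¹

theorem mellin_gaussianPairing_fourierSchwartz (v : E n) (φ : 𝓢(E n, ℂ)) (s : ℂ) :
    mellin (gaussianPairing v (fourierSchwartz n φ)) ((1 - s) / 2) =
      Complex.I * 2 ^ (s + n) * (Real.pi : ℂ) ^ ((n : ℂ) / 2) *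
        mellin (gaussianPairing v φ) ((s + n + 1) / 2) := by
  have hpi : ∀ t : ℝ, 0 < t → (Real.pi / t : ℂ) ^ ((n : ℂ) / 2) =
      (Real.pi : ℂ) ^ ((n : ℂ) / 2) * (t : ℂ) ^ (-((n : ℂ) / 2)) := by
    intro t ht
    rw [div_eq_mul_inv, ← Complex.ofReal_inv,
      Complex.mul_cpow_ofReal_nonneg Real.pi_pos.le (inv_nonneg.mpr ht.le), Complex.ofReal_inv,
      Complex.inv_cpow _ _ (by rw [Complex.arg_ofReal_of_nonneg ht.le]; exact Real.pi_ne_zero.symm),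
      Complex.cpow_neg]
  have h1 : mellin (gaussianPairing v (fourierSchwartz n φ)) ((1 - s) / 2) =
      mellin (fun t : ℝ => (t : ℂ) ^ (-((n : ℂ) / 2) - 1) •
        ((Complex.I / 2 * (Real.pi : ℂ) ^ ((n : ℂ) / 2)) •
          gaussianPairing v φ (1 / 4 * t⁻¹))) ((1 - s) / 2) := by
    refine setIntegral_congr_fun measurableSet_Ioi fun t (ht : 0 < t) => ?_
    have ht' : (t : ℂ) ≠ 0 := by exact_mod_cast ht.ne'
    simp only [smul_eq_mul]
    rw [gaussianPairing_fourierSchwartz v φ ht, hpi t ht,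
      Complex.cpow_sub (-((n : ℂ) / 2)) 1 ht', Complex.cpow_one,
      show 1 / (4 * t) = 1 / 4 * t⁻¹ by field_simp]
    generalize (t : ℂ) ^ (-((n : ℂ) / 2)) = X
    field_simp
  have h4 : ((1 / 4 : ℝ) : ℂ) ^ (-((s + n + 1) / 2)) = 2 ^ (s + n + 1) := by
    rw [show ((1 / 4 : ℝ) : ℂ) = (4 : ℂ)⁻¹ by push_cast; ring, Complex.inv_cpow _ _ (by
      rw [show (4 : ℂ) = ((4 : ℝ) : ℂ) by norm_num, Complex.arg_ofReal_of_nonneg (by norm_num)]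
      exact Real.pi_ne_zero.symm), Complex.cpow_neg, inv_inv,
      show (4 : ℂ) = ((2 : ℝ) : ℂ) * ((2 : ℝ) : ℂ) by norm_num,
      Complex.mul_cpow_ofReal_nonneg (by norm_num) (by norm_num), Complex.ofReal_ofNat,
      ← Complex.cpow_add _ _ two_ne_zero]
    ring_nf
  rw [h1, mellin_cpow_smul, mellin_const_smul,
    mellin_comp_inv (fun t : ℝ => gaussianPairing v φ (1 / 4 * t)),
    mellin_comp_mul_left _ _ (by norm_num : (0 : ℝ) < 1 / 4),
    show -((1 - s) / 2 + (-((n : ℂ) / 2) - 1)) = (s + n + 1) / 2 by ring, h4,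
    Complex.cpow_add _ _ two_ne_zero, Complex.cpow_one]
  simp only [smul_eq_mul]
  ring

/-- The functional equation in the strip `-n < Re s < 0`, where both sides are given by locally
integrable functions. -/
theorem oddRiesz_fourierSchwartz [NeZero n] (v : E n) (φ : 𝓢(E n, ℂ)) {s : ℂ}
    (hs : -(n : ℝ) < s.re) (hs0 : s.re < 0) (hs' : -(n : ℝ) < (-s - n).re) :
    oddRiesz v s hs (fourierSchwartz n φ) = cReg n s * oddRiesz v (-s - n) hs' φ := by
  have hΓ : Complex.Gamma ((1 - s) / 2) ≠ 0 :=
    Complex.Gamma_ne_zero_of_re_pos (by simp; linarith)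
  have h := mellin_gaussianPairing_fourierSchwartz v φ s
  rw [mellin_gaussianPairing v _ hs (by linarith),
    show (s + n + 1) / 2 = (1 - (-s - n)) / 2 by ring,
    mellin_gaussianPairing v φ hs' (by simp; linarith)] at h
  rw [cReg, show (s + n + 1) / 2 = (1 - (-s - n)) / 2 by ring]
  field_simp
  linear_combination h

/-! ### Fourier inversion and parity -/

theorem fourierSchwartz_fourierSchwartz_apply (φ : 𝓢(E n, ℂ)) (x : E n) :
    fourierSchwartz n (fourierSchwartz n φ) x = (2 * Real.pi : ℂ) ^ n * φ (-x) := by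
  have h2π : (0 : ℝ) < 2 * Real.pi := Real.two_pi_pos
  let ψ : 𝓢(E n, ℂ) := 𝓕⁻ φ
  have h1 : ∀ y : E n, fourierSchwartz n φ y = ψ ((2 * Real.pi)⁻¹ • y) := fun y => rfl
  have h2 : ∫ y : E n, ψ y * Complex.exp (Complex.I * (inner ℝ ((2 * Real.pi) • y) x : ℝ)) =
      φ (-x) := by
    have h3 : (𝓕⁻ ψ : 𝓢(E n, ℂ)) x = φ (-x) := by
      rw [fourierInv_coe, Real.fourierInv_eq_fourier_neg, ← fourier_coe,
        FourierTransform.fourier_fourierInv_eq]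
    rw [← h3, fourierInv_coe ψ, Real.fourierInv_eq']
    congr 1
    funext y
    rw [smul_eq_mul, mul_comm, real_inner_smul_left]
    congr 2
    push_cast
    ring
  have h4 := Measure.integral_comp_smul (volume : Measure (E n))
    (fun y => ψ y * Complex.exp (Complex.I * (inner ℝ ((2 * Real.pi) • y) x : ℝ)))
    (2 * Real.pi)⁻¹
  rw [h2, finrank_euclideanSpace, Fintype.card_fin, inv_pow, inv_inv,
    abs_of_pos (by positivity)] at h4
  simp only [smul_smul, mul_inv_cancel₀ h2π.ne', one_smul] at h4
  rw [fourierSchwartz_apply]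
  simp only [h1]
  rw [h4, Complex.real_smul]
  push_cast
  ring

theorem oddRiesz_fourierSchwartz_fourierSchwartz [NeZero n] (v : E n) (φ : 𝓢(E n, ℂ)) {s : ℂ}
    (hs : -(n : ℝ) < s.re) :
    oddRiesz v s hs (fourierSchwartz n (fourierSchwartz n φ)) =
      -(2 * Real.pi : ℂ) ^ n * oddRiesz v s hs φ := by
  rw [oddRiesz_apply, oddRiesz_apply, ← integral_neg_eq_self, ← integral_const_mul]
  congr 1
  funext x
  rw [fourierSchwartz_fourierSchwartz_apply, neg_neg, oddKernel_neg]
  ring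

/-! ### The constant -/

theorem cSlash_eq_cReg {s : ℂ} (hs : s ≠ -1) : cSlash n s = cReg n s := by
  have hs' : s + 1 ≠ 0 := fun h => hs (eq_neg_of_add_eq_zero_left h)
  have hw : -(s + 1) / 2 ≠ 0 := div_ne_zero (neg_ne_zero.mpr hs') two_ne_zero
  have hΓ := Complex.Gamma_add_one _ hw
  rw [show -(s + 1) / 2 + 1 = (1 - s) / 2 by ring] at hΓ
  rw [cSlash, cConst, cReg, hΓ, show s + 1 + (n : ℂ) = s + n + 1 by ring,
    Complex.cpow_add _ _ two_ne_zero, Complex.cpow_one, mul_inv]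
  field_simp

theorem add_div_two_ne_neg_natCast {s : ℂ} (hs : s ∉ rieszPoles n) (m : ℕ) :
    (s + n + 1) / 2 ≠ -(m : ℂ) := fun h => hs ⟨m, by linear_combination 2 * h⟩

theorem cReg_mul_cReg {s : ℂ} (hs : s ∉ rieszPoles n) (hs' : -s - n ∉ rieszPoles n) :
    cReg n s * cReg n (-s - n) = -(2 * Real.pi : ℂ) ^ n := by
  have h1 := Complex.Gamma_ne_zero (add_div_two_ne_neg_natCast hs)
  have h2 := Complex.Gamma_ne_zero (add_div_two_ne_neg_natCast hs')
  rw [show (-s - n + n + 1) / 2 = (1 - s) / 2 by ring] at h2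
  have hpi : (Real.pi : ℂ) ^ ((n : ℂ) / 2) * (Real.pi : ℂ) ^ ((n : ℂ) / 2) = Real.pi ^ n := by
    rw [← Complex.cpow_add _ _ (by exact_mod_cast Real.pi_ne_zero), add_halves,
      Complex.cpow_natCast]
  have h2n : (2 : ℂ) ^ (s + n) * 2 ^ (-s) = 2 ^ n := by
    rw [← Complex.cpow_add _ _ two_ne_zero, show s + n + -s = (n : ℂ) by ring,
      Complex.cpow_natCast]
  rw [cReg, cReg, show (1 - (-s - n)) / 2 = (s + n + 1) / 2 by ring,
    show (-s - n + n + 1) / 2 = (1 - s) / 2 by ring, show -s - n + (n : ℂ) = -s by ring, mul_pow,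
    ← hpi, ← h2n]
  field_simp
  rw [Complex.I_sq]

theorem cReg_of_mem_rieszPoles {s : ℂ} (hs : s ∈ rieszPoles n) : cReg n s = 0 := by
  obtain ⟨k, rfl⟩ := hs
  rw [cReg, show (-(n : ℂ) - 1 - 2 * k + n + 1) / 2 = -(k : ℂ) by ring,
    Complex.Gamma_neg_nat_eq_zero]
  simp

/-- `cReg` without its first `Γ` factor; this part is entire. -/
theorem differentiable_cReg_entire_factor (n : ℕ) : Differentiable ℂ fun s : ℂ =>
    Complex.I * 2 ^ (s + n) * (Real.pi : ℂ) ^ ((n : ℂ) / 2) * (Complex.Gamma ((1 - s) / 2))⁻¹ := by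
  have h1 : Differentiable ℂ fun s : ℂ => (Complex.Gamma ((1 - s) / 2))⁻¹ :=
    Complex.differentiable_one_div_Gamma.comp (f := fun s : ℂ => (1 - s) / 2) (by fun_prop)
  have h2 : Differentiable ℂ fun s : ℂ => (2 : ℂ) ^ (s + n) := fun s =>
    DifferentiableAt.const_cpow (by fun_prop) (Or.inl two_ne_zero)
  fun_prop

theorem cReg_eq (n : ℕ) : cReg n = fun s : ℂ =>
    (Complex.I * 2 ^ (s + n) * (Real.pi : ℂ) ^ ((n : ℂ) / 2) * (Complex.Gamma ((1 - s) / 2))⁻¹) *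
      ((Complex.Gamma ((s + n + 1) / 2))⁻¹)⁻¹ := by
  funext s
  rw [cReg, inv_inv]
  ring

theorem differentiable_inv_Gamma_add_div_two (n : ℕ) :
    Differentiable ℂ fun s : ℂ => (Complex.Gamma ((s + n + 1) / 2))⁻¹ :=
  Complex.differentiable_one_div_Gamma.comp (f := fun s : ℂ => (s + n + 1) / 2) (by fun_prop)

theorem meromorphicAt_cReg (s : ℂ) : MeromorphicAt (cReg n) s := by
  rw [cReg_eq]
  exact ((differentiable_cReg_entire_factor n).analyticAt s).meromorphicAt.mul
    ((differentiable_inv_Gamma_add_div_two n).analyticAt s).meromorphicAt.inv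

theorem analyticAt_cReg {s : ℂ} (hs : s ∉ rieszPoles n) : AnalyticAt ℂ (cReg n) s := by
  rw [cReg_eq]
  exact ((differentiable_cReg_entire_factor n).analyticAt s).mul
    (((differentiable_inv_Gamma_add_div_two n).analyticAt s).inv
      (inv_ne_zero (Complex.Gamma_ne_zero (add_div_two_ne_neg_natCast hs))))

/-! ### The meromorphic continuation of the scalar distributions -/

theorem analyticAt_integral_mul_oddKernel [NeZero n] (v : E n) {s : ℂ} (hs : -(n : ℝ) < s.re)
    (φ : 𝓢(E n, ℂ)) : AnalyticAt ℂ (fun z => ∫ x, φ x * oddKernel v z x) s :=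
  DifferentiableOn.analyticAt (s := {z : ℂ | -(n : ℝ) < z.re})
    (fun _ hz => (differentiableAt_integral_mul_oddKernel v hz φ).differentiableWithinAt)
    ((isOpen_lt continuous_const Complex.continuous_re).mem_nhds hs)

theorem neg_lt_re_neg_sub {s : ℂ} (hs : s.re < 0) : -(n : ℝ) < (-s - n).re := by
  simpa using hs

/-- The continuation of `oddRiesz` to all `s`: for `Re s ≤ -n` it is defined by the functional
equation, in the form `T_s = -(2π)⁻ⁿ cReg(s) 𝓕 T_{-s-n}`. At the poles its value is `0`, because
`cReg` vanishes there. -/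
def oddRieszCont [NeZero n] (v : E n) (s : ℂ) : 𝓢(E n, ℂ) →L[ℂ] ℂ :=
  if h : -(n : ℝ) < s.re then oddRiesz v s h
  else (-((2 * Real.pi : ℂ) ^ n)⁻¹ * cReg n s) •
    (oddRiesz v (-s - n) (neg_lt_re_neg_sub ((not_lt.mp h).trans_lt
      (neg_neg_of_pos (Nat.cast_pos.mpr (NeZero.pos n)))))).comp (fourierSchwartz n)

theorem oddRieszCont_of_lt [NeZero n] (v : E n) {s : ℂ} (hs : -(n : ℝ) < s.re) :
    oddRieszCont v s = oddRiesz v s hs := dif_pos hs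

theorem two_pi_pow_ne_zero (n : ℕ) : (2 * Real.pi : ℂ) ^ n ≠ 0 :=
  pow_ne_zero _ (by exact_mod_cast Real.two_pi_pos.ne')

/-- On the overlap `-n < Re s < 0` the two definitions agree by the functional equation there. -/
theorem oddRieszCont_of_re_neg [NeZero n] (v : E n) {s : ℂ} (hs : s.re < 0) (φ : 𝓢(E n, ℂ)) :
    oddRieszCont v s φ = -((2 * Real.pi : ℂ) ^ n)⁻¹ * cReg n s *
      oddRiesz v (-s - n) (neg_lt_re_neg_sub hs) (fourierSchwartz n φ) := by
  by_cases h : -(n : ℝ) < s.re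
  · have h1 := oddRiesz_fourierSchwartz v (fourierSchwartz n φ) h hs (neg_lt_re_neg_sub hs)
    rw [oddRiesz_fourierSchwartz_fourierSchwartz] at h1
    rw [oddRieszCont_of_lt v h, mul_assoc, ← h1]
    have := two_pi_pow_ne_zero n
    field_simp
  · rw [oddRieszCont, dif_neg h]
    rfl

theorem oddRieszCont_of_mem_rieszPoles [NeZero n] (v : E n) {s : ℂ} (hs : s ∈ rieszPoles n) :
    oddRieszCont v s = 0 := by
  have hre : s.re < 0 := by
    obtain ⟨k, rfl⟩ := hs
    simp only [Complex.sub_re, Complex.neg_re, Complex.natCast_re, Complex.one_re, Complex.mul_re,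
      Complex.re_ofNat, Complex.im_ofNat, Complex.natCast_im]
    linarith [n.cast_nonneg (α := ℝ), k.cast_nonneg (α := ℝ)]
  ext φ
  rw [oddRieszCont_of_re_neg v hre, cReg_of_mem_rieszPoles hs]
  simp

theorem oddRieszCont_eventuallyEq_of_lt [NeZero n] (v : E n) {s : ℂ} (hs : -(n : ℝ) < s.re)
    (φ : 𝓢(E n, ℂ)) :
    (fun z => oddRieszCont v z φ) =ᶠ[𝓝 s] fun z => ∫ x, φ x * oddKernel v z x := by
  filter_upwards [(isOpen_lt continuous_const Complex.continuous_re).mem_nhds hs] with z hz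
  rw [oddRieszCont_of_lt v hz, oddRiesz_apply]

theorem oddRieszCont_eventuallyEq_of_re_neg [NeZero n] (v : E n) {s : ℂ} (hs : s.re < 0)
    (φ : 𝓢(E n, ℂ)) :
    (fun z => oddRieszCont v z φ) =ᶠ[𝓝 s] fun z => -((2 * Real.pi : ℂ) ^ n)⁻¹ * cReg n z *
      ∫ x, fourierSchwartz n φ x * oddKernel v (-z - n) x := by
  filter_upwards [(isOpen_lt Complex.continuous_re continuous_const).mem_nhds hs] with z hz
  rw [oddRieszCont_of_re_neg v hz, oddRiesz_apply]

theorem analyticAt_integral_mul_oddKernel_reflect [NeZero n] (v : E n) {s : ℂ} (hs : s.re < 0)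
    (φ : 𝓢(E n, ℂ)) : AnalyticAt ℂ (fun z => ∫ x, φ x * oddKernel v (-z - n) x) s :=
  (analyticAt_integral_mul_oddKernel v (neg_lt_re_neg_sub hs) φ).comp_of_eq
    (f := fun z : ℂ => -z - n) (by fun_prop) rfl

theorem lt_re_or_re_neg [NeZero n] (s : ℂ) : -(n : ℝ) < s.re ∨ s.re < 0 := by
  have : (0 : ℝ) < n := Nat.cast_pos.mpr (NeZero.pos n)
  by_contra! h
  linarith

theorem analyticAt_oddRieszCont [NeZero n] (v : E n) (φ : 𝓢(E n, ℂ)) {s : ℂ}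
    (hs : s ∉ rieszPoles n) : AnalyticAt ℂ (fun z => oddRieszCont v z φ) s := by
  rcases lt_re_or_re_neg (n := n) s with h | h
  · exact (analyticAt_integral_mul_oddKernel v h φ).congr
      (oddRieszCont_eventuallyEq_of_lt v h φ).symm
  · exact ((analyticAt_const.mul (analyticAt_cReg hs)).mul
      (analyticAt_integral_mul_oddKernel_reflect v h _)).congr
      (oddRieszCont_eventuallyEq_of_re_neg v h φ).symm

theorem meromorphicAt_oddRieszCont [NeZero n] (v : E n) (φ : 𝓢(E n, ℂ)) (s : ℂ) :
    MeromorphicAt (fun z => oddRieszCont v z φ) s := by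
  rcases lt_re_or_re_neg (n := n) s with h | h
  · exact ((analyticAt_integral_mul_oddKernel v h φ).congr
      (oddRieszCont_eventuallyEq_of_lt v h φ).symm).meromorphicAt
  · exact (((MeromorphicAt.const _ s).mul (meromorphicAt_cReg s)).mul
      (analyticAt_integral_mul_oddKernel_reflect v h _).meromorphicAt).congr
      ((oddRieszCont_eventuallyEq_of_re_neg v h φ).symm.filter_mono nhdsWithin_le_nhds)

/-- The functional equation of the scalar distributions. -/
theorem oddRieszCont_fourierSchwartz [NeZero n] (v : E n) (φ : 𝓢(E n, ℂ)) {s : ℂ}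
    (hs : s ∉ rieszPoles n) (hs' : -s - n ∉ rieszPoles n) :
    oddRieszCont v s (fourierSchwartz n φ) = cReg n s * oddRieszCont v (-s - n) φ := by
  have h2π := two_pi_pow_ne_zero n
  rcases lt_re_or_re_neg (n := n) s with h | h
  · -- here `-s - n` lies in the half-plane where the continuation is given by reflection
    have h1 : (-s - n).re < 0 := by simp; linarith
    rw [oddRieszCont_of_re_neg v h1, oddRieszCont_of_lt v h]
    simp only [show -(-s - n) - (n : ℂ) = s by ring]
    have hc := cReg_mul_cReg hs hs'
    field_simp
    linear_combination (oddRiesz v s h (fourierSchwartz n φ)) * hc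
  · rw [oddRieszCont_of_re_neg v h, oddRieszCont_of_lt v (neg_lt_re_neg_sub h),
      oddRiesz_fourierSchwartz_fourierSchwartz]
    field_simp

/-! ### The spinor-valued distributions -/

variable {S : Type*} [NormedAddCommGroup S] [NormedSpace ℂ S] [FiniteDimensional ℂ S]

theorem cliffordMul_eq_sum (ρ : CliffordAlgebra (cliffordForm n) →ₐ[ℝ] Module.End ℂ S) (x : E n) :
    cliffordMul ρ x = ∑ i, ((inner ℝ (EuclideanSpace.basisFun (Fin n) ℝ i) x : ℝ) : ℂ) •
      cliffordMul ρ (EuclideanSpace.basisFun (Fin n) ℝ i) := by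
  ext ψ
  conv_lhs => rw [← (EuclideanSpace.basisFun (Fin n) ℝ).sum_repr' x]
  simp [cliffordMul, map_sum, map_smul]

theorem rieszKernel_eq_sum (ρ : CliffordAlgebra (cliffordForm n) →ₐ[ℝ] Module.End ℂ S) (s : ℂ)
    (x : E n) :
    rieszKernel ρ s x = ∑ i, oddKernel (EuclideanSpace.basisFun (Fin n) ℝ i) s x •
      cliffordMul ρ (EuclideanSpace.basisFun (Fin n) ℝ i) := by
  rw [rieszKernel, cliffordMul_eq_sum, Finset.smul_sum]
  simp only [oddKernel, mul_smul]

/-- The `End(S)`-valued distribution whose components along Clifford multiplication by the standard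
basis vectors are the `oddRieszCont`. -/
def spinorCont [NeZero n] (ρ : CliffordAlgebra (cliffordForm n) →ₐ[ℝ] Module.End ℂ S) (s : ℂ) :
    𝓢'(E n, S →L[ℂ] S) :=
  ContinuousLinearMap.toPointwiseConvergenceCLM _ _ _ _
    (∑ i, (oddRieszCont (EuclideanSpace.basisFun (Fin n) ℝ i) s).smulRight
      (cliffordMul ρ (EuclideanSpace.basisFun (Fin n) ℝ i)))

theorem spinorCont_apply [NeZero n]
    (ρ : CliffordAlgebra (cliffordForm n) →ₐ[ℝ] Module.End ℂ S) (s : ℂ) (φ : 𝓢(E n, ℂ)) :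
    spinorCont ρ s φ = ∑ i, oddRieszCont (EuclideanSpace.basisFun (Fin n) ℝ i) s φ •
      cliffordMul ρ (EuclideanSpace.basisFun (Fin n) ℝ i) := by
  have h : (∑ i, (oddRieszCont (EuclideanSpace.basisFun (Fin n) ℝ i) s).smulRight
      (cliffordMul ρ (EuclideanSpace.basisFun (Fin n) ℝ i)) : 𝓢(E n, ℂ) →L[ℂ] S →L[ℂ] S) φ =
      ∑ i, oddRieszCont (EuclideanSpace.basisFun (Fin n) ℝ i) s φ •
        cliffordMul ρ (EuclideanSpace.basisFun (Fin n) ℝ i) := by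
    rw [sum_apply]
    rfl
  exact h

theorem integrable_sum_smul {ι F : Type*} [Fintype ι] [NormedAddCommGroup F] [NormedSpace ℂ F]
    {f : ι → E n → ℂ} (hf : ∀ i, Integrable (f i)) (γ : ι → F) :
    Integrable (fun x => ∑ i, f i x • γ i) :=
  integrable_finsetSum _ fun i _ => (hf i).smul_const (γ i)

theorem integral_sum_smul {ι F : Type*} [Fintype ι] [NormedAddCommGroup F] [NormedSpace ℂ F]
    [CompleteSpace F] {f : ι → E n → ℂ} (hf : ∀ i, Integrable (f i)) (γ : ι → F) :
    ∫ x, ∑ i, f i x • γ i = ∑ i, (∫ x, f i x) • γ i := by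
  rw [integral_finsetSum _ fun i _ => (hf i).smul_const (γ i)]
  simp only [integral_smul_const]

theorem isRieszSpinor_spinorCont [NeZero n]
    (ρ : CliffordAlgebra (cliffordForm n) →ₐ[ℝ] Module.End ℂ S) :
    IsRieszSpinor ρ (spinorCont ρ) := by
  have hsum : ∀ (s : ℂ) (φ : 𝓢(E n, ℂ)) (x : E n), φ x • rieszKernel ρ s x =
      ∑ i, (φ x * oddKernel (EuclideanSpace.basisFun (Fin n) ℝ i) s x) •
        cliffordMul ρ (EuclideanSpace.basisFun (Fin n) ℝ i) := by
    intro s φ x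
    simp only [rieszKernel_eq_sum, Finset.smul_sum, mul_smul]
  refine ⟨fun s hs φ => ?_, fun s hs φ => ?_, fun φ s hs => ?_, fun φ s => ?_, fun s hs => ?_⟩
  · simp only [hsum]
    exact integrable_sum_smul (fun i => integrable_mul_oddKernel _ hs φ) _
  · simp only [hsum]
    have := FiniteDimensional.complete ℂ S
    rw [integral_sum_smul (fun i => integrable_mul_oddKernel _ hs φ), spinorCont_apply]
    simp only [oddRieszCont_of_lt _ hs, oddRiesz_apply]
  · simp only [spinorCont_apply]
    exact Finset.analyticAt_fun_sum _ fun i _ => (analyticAt_oddRieszCont _ φ hs).smul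
      analyticAt_const
  · simp only [spinorCont_apply]
    exact MeromorphicAt.fun_sum fun i _ => (meromorphicAt_oddRieszCont _ φ s).smul
      (MeromorphicAt.const _ s)
  · ext φ : 1
    simp [spinorCont_apply, oddRieszCont_of_mem_rieszPoles _ hs]

theorem isRieszSpinor_zero_dim
    (ρ : CliffordAlgebra (cliffordForm 0) →ₐ[ℝ] Module.End ℂ S) :
    IsRieszSpinor ρ (fun _ => 0) := by
  have h : ∀ s x, rieszKernel ρ s x = 0 := by
    intro s x
    rw [rieszKernel, Subsingleton.elim x 0, cliffordMul]
    simp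
  refine ⟨fun s hs φ => ?_, fun s hs φ => ?_, fun φ s hs => ?_, fun φ s => ?_, fun s hs => rfl⟩
  · simp [h]
  · simp [h]
  · exact analyticAt_const
  · exact MeromorphicAt.const _ s

/-- The functional equation with the regularised constant, which needs no condition at `s = -1`. -/
theorem IsRieszSpinor.fourierTempered_eq
    {ρ : CliffordAlgebra (cliffordForm n) →ₐ[ℝ] Module.End ℂ S} {R : ℂ → 𝓢'(E n, S →L[ℂ] S)}
    (hR : IsRieszSpinor ρ R) {s : ℂ} (hs : s ∉ rieszPoles n) (hs' : -s - n ∉ rieszPoles n) :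
    fourierTempered n (R s) = cReg n s • R (-s - n) := by
  rcases Nat.eq_zero_or_pos n with rfl | hn
  · rw [hR.unique (isRieszSpinor_zero_dim ρ), map_zero]
    exact (smul_zero _).symm
  · have : NeZero n := ⟨hn.ne'⟩
    rw [hR.unique (isRieszSpinor_spinorCont ρ)]
    ext φ : 1
    rw [fourierTempered_apply, spinorCont_apply]
    simp only [oddRieszCont_fourierSchwartz _ φ hs hs', mul_smul]
    rw [← Finset.smul_sum, ← spinorCont_apply]
    rfl

theorem isRieszSpinor_rieszSpinor (ρ : CliffordAlgebra (cliffordForm n) →ₐ[ℝ] Module.End ℂ S) :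
    IsRieszSpinor ρ (rieszSpinor ρ) := by
  refine Classical.epsilon_spec (p := IsRieszSpinor ρ) ?_
  rcases Nat.eq_zero_or_pos n with rfl | hn
  · exact ⟨_, isRieszSpinor_zero_dim ρ⟩
  · have : NeZero n := ⟨hn.ne'⟩
    exact ⟨_, isRieszSpinor_spinorCont ρ⟩

/-- The poles are the zeros of the entire function `1 / Γ((s+n+1)/2)`. -/
theorem eventually_notMem_rieszPoles (n : ℕ) (s : ℂ) : ∀ᶠ z in 𝓝[≠] s, z ∉ rieszPoles n := by
  by_contra hcon
  have hfreq : ∃ᶠ z in 𝓝[≠] s, (Complex.Gamma ((z + n + 1) / 2))⁻¹ = 0 := by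
    refine Frequently.mono (p := fun z => z ∈ rieszPoles n) hcon fun z hz => ?_
    obtain ⟨k, rfl⟩ := hz
    rw [show (-(n : ℂ) - 1 - 2 * k + n + 1) / 2 = -(k : ℂ) by ring,
      Complex.Gamma_neg_nat_eq_zero, inv_zero]
  have hzero := AnalyticOnNhd.eqOn_zero_of_preconnected_of_frequently_eq_zero (U := Set.univ)
    (fun z _ => (differentiable_inv_Gamma_add_div_two n).analyticAt z) isPreconnected_univ
    (Set.mem_univ s) hfreq (Set.mem_univ (1 - n : ℂ))
  simp at hzero

theorem eventually_neg_sub_notMem_rieszPoles (n : ℕ) (s : ℂ) :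
    ∀ᶠ z : ℂ in 𝓝[≠] s, -z - n ∉ rieszPoles n := by
  have h : Tendsto (fun z : ℂ => -z - n) (𝓝[≠] s) (𝓝[≠] (-s - n)) := by
    refine tendsto_nhdsWithin_iff.mpr ⟨?_, ?_⟩
    · exact (Continuous.tendsto (by fun_prop) s).mono_left nhdsWithin_le_nhds
    · filter_upwards [self_mem_nhdsWithin] with z hz
      simpa using hz
  exact h.eventually (eventually_notMem_rieszPoles n _)

end

end SpinorRiesz

theorem proposition2p3 (n : ℕ) {S : Type*} [NormedAddCommGroup S] [NormedSpace ℂ S]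
    [FiniteDimensional ℂ S]
    (ρ : CliffordAlgebra (SpinorRiesz.cliffordForm n) →ₐ[ℝ] Module.End ℂ S) :
    -- the meromorphic continuation exists
    SpinorRiesz.IsRieszSpinor ρ (SpinorRiesz.rieszSpinor ρ) ∧
    -- the identity wherever both families and the quotient defining the constant are regular
    (∀ s : ℂ, s ∉ SpinorRiesz.rieszPoles n → -s - n ∉ SpinorRiesz.rieszPoles n → s ≠ -1 →
      SpinorRiesz.fourierTempered n (SpinorRiesz.rieszSpinor ρ s) =
        SpinorRiesz.cSlash n s • SpinorRiesz.rieszSpinor ρ (-s - n)) ∧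
    -- the identity at all points where the left-hand side is regular, the right-hand side being
    -- continued through its removable singularities
    (∀ s : ℂ, s ∉ SpinorRiesz.rieszPoles n →
      Tendsto (fun z : ℂ => SpinorRiesz.cSlash n z • SpinorRiesz.rieszSpinor ρ (-z - n))
        (𝓝[≠] s) (𝓝 (SpinorRiesz.fourierTempered n (SpinorRiesz.rieszSpinor ρ s)))) := by
  have hR := SpinorRiesz.isRieszSpinor_rieszSpinor ρ
  have heq : ∀ s : ℂ, s ∉ SpinorRiesz.rieszPoles n → -s - n ∉ SpinorRiesz.rieszPoles n → s ≠ -1 →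
      SpinorRiesz.fourierTempered n (SpinorRiesz.rieszSpinor ρ s) =
        SpinorRiesz.cSlash n s • SpinorRiesz.rieszSpinor ρ (-s - n) := fun s hs hs' hs1 => by
    rw [hR.fourierTempered_eq hs hs', SpinorRiesz.cSlash_eq_cReg hs1]
  refine ⟨hR, heq, fun s hs => ?_⟩
  have hlim : Tendsto (fun z => SpinorRiesz.fourierTempered n (SpinorRiesz.rieszSpinor ρ z))
      (𝓝[≠] s) (𝓝 (SpinorRiesz.fourierTempered n (SpinorRiesz.rieszSpinor ρ s))) :=
    PointwiseConvergenceCLM.tendsto_iff_forall_tendsto.mpr fun φ =>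
      (hR.analyticAt (SpinorRiesz.fourierSchwartz n φ) s hs).continuousAt.tendsto.mono_left
        nhdsWithin_le_nhds
  have hne : ∀ᶠ z : ℂ in 𝓝[≠] s, z ≠ -1 := by
    rcases eq_or_ne s (-1) with rfl | h
    · exact self_mem_nhdsWithin
    · exact eventually_ne_nhdsWithin h
  refine hlim.congr' ?_
  filter_upwards [SpinorRiesz.eventually_notMem_rieszPoles n s,
    SpinorRiesz.eventually_neg_sub_notMem_rieszPoles n s, hne] with z hz hz' hz1
  exact heq z hz hz' hz1
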